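/- Let $\boldsymbol{Q}$ be the class of probability distributions $F$ on $\mathbb{R}$ for which there exist infinitely divisible distributions $F_1,F_2$ with $F_1=F*F_2$. For a probability distribution $F$ on $\mathbb{R}$ with characteristic function $f$, let $F=c_dF_d+c_aF_a+c_sF_s$ be its Lebesgue decomposition into discrete, absolutely continuous and continuous singular parts; if $c_d>0$, let $f_d$ be the characteristic function of $F_d$ and $\mu_d=\inf_{t\in\mathbb{R}}|f_d(t)|$. One says that $F$ has the dominated continuous singular part if $c_s<c_d\mu_d$ in the case $\mu_d>0$, and $c_s=0$ in the case $\mu_d=0$. Let $B_k$ ($k\ge 1$) be the distribution giving mass $\tfrac12$ to each of the points $\pm 1/k!$, and let $\mathcal{B}=B_1*B_2*\cdots$ be the infinite symmetric Bernoulli convolution, i.e. the law of $\sum_{k\ge1}\varepsilon_k/k!$ with independent signs $\varepsilon_k=\pm1$ of probability $\tfrac12$ each. Then $B_1*\cdots*B_n$ converges weakly to $\mathcal{B}$ as $n\to\infty$, the characteristic function of $\mathcal{B}$ is $\prod_{k=1}^{\infty}\cos(t/k!)$, $t\in\mathbb{R}$, and $\mathcal{B}$ is continuous singular (it has no atoms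 and is singular with respect to Lebesgue measure). Let $F_*=\tfrac12\delta_0+\tfrac12\mathcal{B}$, with characteristic function $f_*$. Then: 1. $F_*\notin\boldsymbol{Q}$. 2. $f_*(t)\neq 0$ for every $t\in\mathbb{R}$. 3. For $F=F_*$ one has $c_d=\tfrac12$, $c_a=0$, $c_s=\tfrac12$, $f_d\equiv 1$ and $\mu_d=1$. Hence $c_s=c_d\mu_d$, and $F_*$ does not have the dominated continuous singular part. 4. Consequently, the following assertion is false: for every probability distribution $F$ on $\mathbb{R}$ with $c_d>0$, $\mu_d>0$ and $c_s=c_d\mu_d$, one has $F\in\boldsymbol{Q}$ if and only if $f(t)\ne0$ for all $t\in\mathbb{R}$ and $\mu_d>0$. That is, in the criterion "$F\in\boldsymbol{Q}$ if and only if $f$ has no real zeros and $\mu_d>0$", valid for $F$ with $c_d>0$ and the dominated continuous singular part, the domination condition cannot be relaxed to admit the case $c_s=c_d\mu_d>0$. -/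

import Mathlib

open MeasureTheory Filter Topology

noncomputable section

/-! Probability laws on the real line are represented by Borel probability measures (equivalently, by
their distribution functions); `∗` is convolution and `charFun` is the characteristic function. -/

/-- The `n`-fold convolution power of a law `ν` on the real line. -/
def convPower (ν : Measure ℝ) : ℕ → Measure ℝ
  | 0 => Measure.dirac 0
  | n + 1 => (convPower ν n).conv ν

/-- Infinite divisibility: for every positive integer `n` the law is the `n`-fold convolution power
of some probability law. -/
def IsInfinitelyDivisible (F : Measure ℝ) : Prop :=
  IsProbabilityMeasure F ∧
    ∀ n : ℕ, 0 < n → ∃ G : Measure ℝ, IsProbabilityMeasure G ∧ F = convPower G n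

/-- The class `Q` of rational-infinitely divisible laws: `F₁ = F ∗ F₂` for some infinitely
divisible `F₁` and `F₂`. -/
def ClassQ : Set (Measure ℝ) :=
  {F | IsProbabilityMeasure F ∧ ∃ F₁ F₂ : Measure ℝ,
    IsInfinitelyDivisible F₁ ∧ IsInfinitelyDivisible F₂ ∧ F₁ = F.conv F₂}

/-- The set of atoms of a law. -/
def atomSet (F : Measure ℝ) : Set ℝ := {x | F {x} ≠ 0}

/-- The weight `c_d` of the discrete part in the Lebesgue decomposition of `F`. -/
def discreteWeight (F : Measure ℝ) : ℝ := F.real (atomSet F)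

/-- The weight `c_a` of the absolutely continuous part in the Lebesgue decomposition of `F`. -/
def absContWeight (F : Measure ℝ) : ℝ :=
  (volume.withDensity (F.rnDeriv volume)).real Set.univ

/-- The weight `c_s` of the continuous singular part in the Lebesgue decomposition of `F`: the mass
that the Lebesgue-singular part of `F` gives to the complement of the atoms. -/
def contSingWeight (F : Measure ℝ) : ℝ := (F.singularPart volume).real (atomSet F)ᶜ

/-- The normalized discrete component `F_d` (meaningful when `c_d > 0`). -/
def discreteLaw (F : Measure ℝ) : Measure ℝ := (F (atomSet F))⁻¹ • F.restrict (atomSet F)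

/-- `μ_d = inf_t |f_d(t)|`, where `f_d` is the characteristic function of `F_d`. -/
def discreteInf (F : Measure ℝ) : ℝ := ⨅ t : ℝ, ‖charFun (discreteLaw F) t‖

/-- `F` has the dominated continuous singular part: `c_s < c_d μ_d` if `μ_d > 0`, and `c_s = 0` if
`μ_d = 0`. -/
def HasDominatedSingularPart (F : Measure ℝ) : Prop :=
  (0 < discreteInf F → contSingWeight F < discreteWeight F * discreteInf F) ∧
    (discreteInf F = 0 → contSingWeight F = 0)

/-- The symmetric Bernoulli law on the two points `± a`, with equal probabilities. -/
def symBernoulli (a : ℝ) : Measure ℝ :=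
  (2 : ENNReal)⁻¹ • Measure.dirac (-a) + (2 : ENNReal)⁻¹ • Measure.dirac a

instance isProbabilityMeasure_symBernoulli (a : ℝ) : IsProbabilityMeasure (symBernoulli a) :=
  ⟨by simp [symBernoulli, ENNReal.inv_two_add_inv_two]⟩

/-- The finite convolution `B₁ ∗ B₂ ∗ ⋯ ∗ Bₙ`, where `B_k` is the symmetric Bernoulli law on
`± 1 / k!`. -/
def bernoulliPartialConv : ℕ → Measure ℝ
  | 0 => Measure.dirac 0
  | n + 1 => (bernoulliPartialConv n).conv (symBernoulli (1 / ((n + 1).factorial : ℝ)))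

instance isProbabilityMeasure_bernoulliPartialConv (n : ℕ) :
    IsProbabilityMeasure (bernoulliPartialConv n) := by
  induction n with
  | zero => unfold bernoulliPartialConv; infer_instance
  | succ n ih => unfold bernoulliPartialConv; infer_instance

/-- The infinite symmetric Bernoulli convolution `F_s = B₁ ∗ B₂ ∗ ⋯`: the law of the random series
`∑_{k ≥ 1} ε_k / k!` with independent signs `ε_k`, each equal to `± 1` with probability `1/2`. -/
def bernoulliConv : Measure ℝ :=
  (Measure.infinitePi fun _ : ℕ => symBernoulli 1).map
    fun ε => ∑' k : ℕ, ε k / ((k + 1).factorial : ℝ)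

instance isProbabilityMeasure_bernoulliConv : IsProbabilityMeasure bernoulliConv := by
  refine Measure.isProbabilityMeasure_map (Measurable.aemeasurable ?_)
  fun_prop

/-- The law `F_* = ½ δ₀ + ½ F_s`. -/
def starLaw : Measure ℝ :=
  (2 : ENNReal)⁻¹ • Measure.dirac 0 + (2 : ENNReal)⁻¹ • bernoulliConv

end

/-!
Why the characteristic function `f = (1 + g) / 2` of `starLaw`, with `g t = ∏ cos (t / k!)`, is not
a quotient of infinitely divisible characteristic functions although it never vanishes.

If `φ` is infinitely divisible, then `|φ|^(2/n)` is for every `n` the characteristic function of a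
symmetric law. For a real characteristic function `h` the second difference
`h (t + s) + h (t - s) - 2 h t` equals `2 ∫ cos (t x) (cos (s x) - 1)`, which is at most
`2 (1 - h s)` in modulus. Multiplying by `n` and letting `n → ∞` bounds the second differences of
`log |φ|²` by `-2 log |φ s|²`, uniformly in `t`
(`IsInfinitelyDivisible.abs_second_difference_log_le`); `φ` has no zeros by the same inequality.
Hence for a law of `ClassQ` the second differences of `log |f|²` with a fixed step are bounded
(`exists_abs_second_difference_log_le_of_mem_ClassQ`). No Lévy–Khintchine representation is needed.

For even `N` the shift by `π N!` reverses the sign of exactly one of the first `N` cosine factors,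
and the remaining factors are close to one, so `g (s + π N!) → -g s`
(`tendsto_cosProd_add_pi_mul_factorial`). Therefore `f (π N!) → 0` while
`f (π N! ± 1) → (1 - g 1) / 2 > 0`, and the second differences of `log |f|²` are unbounded. On the
other hand `|g t| < 1` for `t ≠ 0` and `g 0 = 1`, so that `f > 0`.

The Bernoulli convolution is studied through the map from sign sequences to sums. It is injective,
because `1 / k!` exceeds the sum of the later terms, hence there are no atoms. Its image lies within
`2 / (n + 1)!` of at most `2 ^ n` points for every `n`, hence is a null set. Both rest on the
tail estimate `abs_sub_le_of_factorial_increments`, which also controls the infinite product.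
Dominated convergence along the partial sums gives the characteristic function, and Lévy's
continuity theorem the weak convergence.
-/

/-! ### Second differences of the logarithm of a characteristic function -/

theorem integrable_cos_mul (μ : Measure ℝ) [IsProbabilityMeasure μ] (t : ℝ) :
    Integrable (fun x => Real.cos (t * x)) μ := by
  refine Integrable.of_bound (by fun_prop) 1 (Eventually.of_forall fun x => ?_)
  simpa using Real.abs_cos_le_one (t * x)

theorem re_charFun_eq_integral_cos (μ : Measure ℝ) [IsProbabilityMeasure μ] (t : ℝ) :
    (charFun μ t).re = ∫ x, Real.cos (t * x) ∂μ := by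
  rw [charFun_apply_real]
  have h : Integrable (fun x : ℝ => Complex.exp (t * x * Complex.I)) μ := by
    refine Integrable.of_bound (by fun_prop) 1 (Eventually.of_forall fun x => ?_)
    rw [← Complex.ofReal_mul, Complex.norm_exp_ofReal_mul_I]
  have := integral_re h
  simp only [RCLike.re_to_complex] at this
  rw [← this]
  refine integral_congr_ae (Eventually.of_forall fun x => ?_)
  simp only
  rw [← Complex.ofReal_mul, Complex.exp_ofReal_mul_I_re]

/-- The second difference of `h = Re φ` is `2 ∫ cos (t x) (cos (s x) - 1) dμ`, and `|cos| ≤ 1`. -/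
theorem abs_second_difference_re_charFun_le (μ : Measure ℝ) [IsProbabilityMeasure μ] (t s : ℝ) :
    |(charFun μ (t + s)).re + (charFun μ (t - s)).re - 2 * (charFun μ t).re| ≤
      2 * (1 - (charFun μ s).re) := by
  have hc := integrable_cos_mul μ
  have h1 : (charFun μ (t + s)).re + (charFun μ (t - s)).re - 2 * (charFun μ t).re =
      ∫ x, 2 * Real.cos (t * x) * (Real.cos (s * x) - 1) ∂μ := by
    simp only [re_charFun_eq_integral_cos]
    rw [← integral_const_mul, ← integral_add (hc _) (hc _),
      ← integral_sub (by exact (hc _).add (hc _)) ((hc _).const_mul 2)]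
    refine integral_congr_ae (Eventually.of_forall fun x => ?_)
    simp only [add_mul, sub_mul, Real.cos_add, Real.cos_sub]
    ring
  have h2 : 2 * (1 - (charFun μ s).re) = ∫ x, 2 * (1 - Real.cos (s * x)) ∂μ := by
    rw [re_charFun_eq_integral_cos, integral_const_mul, integral_sub (integrable_const _) (hc _)]
    simp
  rw [h1, h2, ← Real.norm_eq_abs]
  refine norm_integral_le_of_norm_le (((integrable_const 1).sub (hc s)).const_mul 2)
    (Eventually.of_forall fun x => ?_)
  rw [Real.norm_eq_abs, abs_mul, abs_mul, abs_two, abs_sub_comm,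
    abs_of_nonneg (sub_nonneg.2 (Real.cos_le_one (s * x)))]
  have := sub_nonneg.2 (Real.cos_le_one (s * x))
  have := Real.abs_cos_le_one (t * x)
  nlinarith

/-- The same bound for `|φ|²`, which is the characteristic function of the symmetrization of `G`. -/
theorem abs_second_difference_normSq_charFun_le (G : Measure ℝ) [IsProbabilityMeasure G]
    (t s : ℝ) :
    |‖charFun G (t + s)‖ ^ 2 + ‖charFun G (t - s)‖ ^ 2 - 2 * ‖charFun G t‖ ^ 2| ≤
      2 * (1 - ‖charFun G s‖ ^ 2) := by
  have : IsProbabilityMeasure (G.map fun x => -1 * x) :=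
    Measure.isProbabilityMeasure_map (by fun_prop)
  have h : ∀ u, (charFun (G.conv (G.map fun x => -1 * x)) u).re = ‖charFun G u‖ ^ 2 := fun u => by
    rw [charFun_conv, charFun_map_mul, neg_one_mul, charFun_neg, Complex.mul_conj,
      Complex.ofReal_re, Complex.normSq_eq_norm_sq]
  simpa only [h] using abs_second_difference_re_charFun_le (G.conv (G.map fun x => -1 * x)) t s

/-! ### Characteristic functions of infinitely divisible laws -/

theorem isProbabilityMeasure_convPower (G : Measure ℝ) [IsProbabilityMeasure G] (n : ℕ) :
    IsProbabilityMeasure (convPower G n) := by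
  induction n with
  | zero => unfold convPower; infer_instance
  | succ n ih => unfold convPower; infer_instance

theorem charFun_convPower (G : Measure ℝ) [IsProbabilityMeasure G] (n : ℕ) (t : ℝ) :
    charFun (convPower G n) t = charFun G t ^ n := by
  induction n with
  | zero => simp [convPower, charFun_dirac]
  | succ n ih =>
    have := isProbabilityMeasure_convPower G n
    rw [convPower, charFun_conv, ih, pow_succ]

/-- The functions `|φ|^(2/n)` attached to an infinitely divisible law inherit the second difference
bound, being themselves squared moduli of characteristic functions. -/
theorem IsInfinitelyDivisible.abs_second_difference_rpow_le {F : Measure ℝ}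
    (hF : IsInfinitelyDivisible F) {n : ℕ} (hn : 0 < n) (t s : ℝ) :
    |(‖charFun F (t + s)‖ ^ 2) ^ (n : ℝ)⁻¹ + (‖charFun F (t - s)‖ ^ 2) ^ (n : ℝ)⁻¹ -
        2 * (‖charFun F t‖ ^ 2) ^ (n : ℝ)⁻¹| ≤ 2 * (1 - (‖charFun F s‖ ^ 2) ^ (n : ℝ)⁻¹) := by
  obtain ⟨G, hG, rfl⟩ := hF.2 n hn
  have h : ∀ u, (‖charFun (convPower G n) u‖ ^ 2) ^ (n : ℝ)⁻¹ = ‖charFun G u‖ ^ 2 := fun u => by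
    rw [charFun_convPower, norm_pow, ← pow_mul, mul_comm, pow_mul,
      Real.pow_rpow_inv_natCast (by positivity) hn.ne']
  simpa only [h] using abs_second_difference_normSq_charFun_le G t s

theorem IsInfinitelyDivisible.charFun_two_mul_ne_zero {F : Measure ℝ}
    (hF : IsInfinitelyDivisible F) {t : ℝ} (ht : charFun F t ≠ 0) : charFun F (2 * t) ≠ 0 := by
  intro h0
  have := hF.1
  -- A zero at `2 t` forces `|φ t|^(2/n) ≤ 3/4` for all `n`, although these roots tend to `1`.
  have hle : ∀ᶠ n : ℕ in atTop, (‖charFun F t‖ ^ 2) ^ (n : ℝ)⁻¹ ≤ 3 / 4 := by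
    filter_upwards [eventually_gt_atTop 0] with n hn
    have h := hF.abs_second_difference_rpow_le hn t t
    rw [← two_mul, h0, sub_self, charFun_zero] at h
    have hn' : (n : ℝ)⁻¹ ≠ 0 := by positivity
    simp only [norm_zero, ne_eq, OfNat.ofNat_ne_zero, not_false_eq_true, zero_pow,
      Real.zero_rpow hn', probReal_univ, norm_one, one_pow, Real.one_rpow, Complex.ofReal_one] at h
    linarith [(abs_le.1 h).1]
  have hlim : Tendsto (fun n : ℕ => (‖charFun F t‖ ^ 2) ^ (n : ℝ)⁻¹) atTop (𝓝 1) := by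
    have hpos : 0 < ‖charFun F t‖ ^ 2 := by positivity
    simpa [Function.comp_def] using (Real.continuousAt_const_rpow hpos.ne').tendsto.comp
      (tendsto_inv_atTop_nhds_zero_nat (𝕜 := ℝ))
  linarith [le_of_tendsto hlim hle]

theorem IsInfinitelyDivisible.charFun_ne_zero {F : Measure ℝ}
    (hF : IsInfinitelyDivisible F) (t : ℝ) : charFun F t ≠ 0 := by
  have := hF.1
  have hcont : Continuous (charFun F) := by fun_prop
  have hlim : Tendsto (fun k : ℕ => charFun F (t * (2⁻¹) ^ k)) atTop (𝓝 1) := by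
    have h : Tendsto (fun k : ℕ => t * (2⁻¹ : ℝ) ^ k) atTop (𝓝 0) := by
      simpa using (tendsto_pow_atTop_nhds_zero_of_lt_one (r := (2⁻¹ : ℝ)) (by norm_num)
        (by norm_num)).const_mul t
    have h' := (hcont.tendsto 0).comp h
    rwa [charFun_zero, probReal_univ, Complex.ofReal_one] at h'
  obtain ⟨k, hk⟩ := (hlim.eventually_ne one_ne_zero).exists
  have hstep : ∀ j : ℕ, j ≤ k → charFun F (t * 2⁻¹ ^ (k - j)) ≠ 0 := by
    intro j
    induction j with
    | zero => intro _; simpa using hk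
    | succ j ih =>
      intro hj
      have h := hF.charFun_two_mul_ne_zero (ih (by omega))
      have e : k - j = (k - (j + 1)) + 1 := by omega
      rw [e, pow_succ] at h
      convert h using 2
      ring
  simpa using hstep k le_rfl

/-- The second difference of `log |φ|²` at `t` is bounded uniformly in `t`. This is the limit of
the bounds for `|φ|^(2/n)`, since `n (a^(1/n) - 1)` tends to `log a`. -/
theorem IsInfinitelyDivisible.abs_second_difference_log_le {F : Measure ℝ}
    (hF : IsInfinitelyDivisible F) (t s : ℝ) :
    |Real.log (‖charFun F (t + s)‖ ^ 2) + Real.log (‖charFun F (t - s)‖ ^ 2) -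
        2 * Real.log (‖charFun F t‖ ^ 2)| ≤ -2 * Real.log (‖charFun F s‖ ^ 2) := by
  have hlim : ∀ u, Tendsto (fun n : ℕ => (n : ℝ) * ((‖charFun F u‖ ^ 2) ^ (n : ℝ)⁻¹ - 1)) atTop
      (𝓝 (Real.log (‖charFun F u‖ ^ 2))) := fun u => by
    have hpos : 0 < ‖charFun F u‖ ^ 2 := by
      have := hF.charFun_ne_zero u
      positivity
    have h : Tendsto (fun n : ℕ => (n : ℝ)⁻¹) atTop (𝓝[>] 0) :=
      tendsto_inv_atTop_nhdsGT_zero.comp tendsto_natCast_atTop_atTop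
    simpa [Function.comp_def] using (tendsto_rpow_sub_one_log hpos).comp h
  refine le_of_tendsto_of_tendsto
    (((hlim (t + s)).add (hlim (t - s))).sub ((hlim t).const_mul 2)).abs
    ((hlim s).const_mul (-2)) ?_
  filter_upwards [eventually_gt_atTop 0] with n hn
  have h := mul_le_mul_of_nonneg_left (hF.abs_second_difference_rpow_le hn t s) n.cast_nonneg
  rw [← Nat.abs_cast, ← abs_mul, Nat.abs_cast] at h
  convert h using 1
  · congr 1
    ring
  · ring

/-- For a law of the class `Q` the logarithm of `|f|²` has, for each fixed step `s`, second
differences bounded uniformly on the line: it is a difference of two such functions. -/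
theorem exists_abs_second_difference_log_le_of_mem_ClassQ {F : Measure ℝ} (hF : F ∈ ClassQ)
    (s : ℝ) : ∃ C : ℝ, ∀ t,
      |Real.log (‖charFun F (t + s)‖ ^ 2) + Real.log (‖charFun F (t - s)‖ ^ 2) -
        2 * Real.log (‖charFun F t‖ ^ 2)| ≤ C := by
  obtain ⟨hFp, F₁, F₂, h₁, h₂, rfl⟩ := hF
  have := h₂.1
  refine ⟨-2 * Real.log (‖charFun (F.conv F₂) s‖ ^ 2) + -2 * Real.log (‖charFun F₂ s‖ ^ 2),
    fun t => ?_⟩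
  have hlog : ∀ u, Real.log (‖charFun F u‖ ^ 2) =
      Real.log (‖charFun (F.conv F₂) u‖ ^ 2) - Real.log (‖charFun F₂ u‖ ^ 2) := fun u => by
    have h := h₁.charFun_ne_zero u
    rw [charFun_conv] at h ⊢
    have ha := norm_ne_zero_iff.2 (left_ne_zero_of_mul h)
    have hb := norm_ne_zero_iff.2 (right_ne_zero_of_mul h)
    rw [norm_mul, mul_pow, Real.log_mul (pow_ne_zero 2 ha) (pow_ne_zero 2 hb)]
    ring
  have e₁ := abs_le.1 (h₁.abs_second_difference_log_le t s)
  have e₂ := abs_le.1 (h₂.abs_second_difference_log_le t s)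
  simp only [hlog]
  rw [abs_le]
  constructor <;> linarith [e₁.1, e₁.2, e₂.1, e₂.2]

/-! ### Convergence at factorial speed -/

/-- The estimate comes from telescoping: `u k = (1 + 1 / (k + 1)) / (k + 1)!` satisfies
`1 / (k + 1)! ≤ u k - u (k + 1)`. -/
theorem abs_sub_le_of_factorial_increments {a : ℕ → ℝ} {c L : ℝ}
    (h : ∀ k, |a (k + 1) - a k| ≤ c / ((k + 1).factorial : ℝ)) (hL : Tendsto a atTop (𝓝 L))
    (n : ℕ) : |L - a n| ≤ c * ((1 + 1 / ((n : ℝ) + 1)) / ((n + 1).factorial : ℝ)) := by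
  set u : ℕ → ℝ := fun k => (1 + 1 / ((k : ℝ) + 1)) / ((k + 1).factorial : ℝ) with hu
  have hc : 0 ≤ c := by simpa using (abs_nonneg _).trans (h 0)
  have hstep : ∀ k, 1 / ((k + 1).factorial : ℝ) ≤ u k - u (k + 1) := by
    intro k
    have hf : (0 : ℝ) < (k + 1).factorial := by positivity
    have e : u k - u (k + 1) - 1 / ((k + 1).factorial : ℝ) =
        1 / (((k : ℝ) + 1) * ((k : ℝ) + 2) ^ 2 * (k + 1).factorial) := by
      simp only [hu]
      rw [Nat.factorial_succ (k + 1)]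
      push_cast
      field_simp
      ring
    have : 0 ≤ 1 / (((k : ℝ) + 1) * ((k : ℝ) + 2) ^ 2 * (k + 1).factorial) := by positivity
    linarith
  have hind : ∀ m, |a (n + m) - a n| ≤ c * (u n - u (n + m)) := by
    intro m
    induction m with
    | zero => simp
    | succ m ih =>
      have h1 := abs_sub_le (a (n + m + 1)) (a (n + m)) (a n)
      have h2 := mul_le_mul_of_nonneg_left (hstep (n + m)) hc
      rw [mul_one_div] at h2
      rw [← add_assoc]
      linarith [h (n + m)]
  refine le_of_tendsto (((tendsto_add_atTop_iff_nat n).2 hL).sub_const (a n)).abs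
    (Eventually.of_forall fun m => ?_)
  rw [add_comm m n]
  refine (hind m).trans (mul_le_mul_of_nonneg_left ?_ hc)
  have : 0 ≤ u (n + m) := by positivity
  linarith

theorem abs_sub_le_two_mul_of_factorial_increments {a : ℕ → ℝ} {c L : ℝ}
    (h : ∀ k, |a (k + 1) - a k| ≤ c / ((k + 1).factorial : ℝ)) (hL : Tendsto a atTop (𝓝 L))
    (n : ℕ) : |L - a n| ≤ c * (2 / ((n + 1).factorial : ℝ)) := by
  have hc : 0 ≤ c := by simpa using (abs_nonneg _).trans (h 0)
  refine (abs_sub_le_of_factorial_increments h hL n).trans ?_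
  have : 1 / ((n : ℝ) + 1) ≤ 1 := by
    rw [div_le_one (by positivity)]
    linarith [n.cast_nonneg (α := ℝ)]
  gcongr
  linarith

/-! ### The random series with independent signs -/

/-- The joint law of a sequence of independent fair signs. -/
noncomputable def signLaw : Measure (ℕ → ℝ) :=
  Measure.infinitePi fun _ : ℕ => symBernoulli 1

instance isProbabilityMeasure_signLaw : IsProbabilityMeasure signLaw := by
  unfold signLaw; infer_instance

/-- The set of sequences with values `± 1`, which carries `signLaw`. -/
def signSequences : Set (ℕ → ℝ) := {ε | ∀ k, ε k = -1 ∨ ε k = 1}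

theorem ae_mem_signSequences : ∀ᵐ ε ∂signLaw, ε ∈ signSequences := by
  refine ae_all_iff.2 fun k => ?_
  have h : ∀ᵐ x ∂(signLaw.map fun ε => ε k), x = -1 ∨ x = 1 := by
    rw [signLaw, Measure.infinitePi_map_eval, symBernoulli, ae_add_measure_iff]
    refine ⟨Measure.ae_smul_measure ?_ _, Measure.ae_smul_measure ?_ _⟩ <;> simp
  exact ae_of_ae_map (measurable_pi_apply k).aemeasurable h

/-- The partial sum `∑_{k ≤ n} ε_k / k!` (with the signs indexed from zero). -/
noncomputable def signPartialSum (n : ℕ) (ε : ℕ → ℝ) : ℝ :=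
  ∑ k ∈ Finset.range n, ε k / ((k + 1).factorial : ℝ)

/-- The sum `∑_{k ≥ 1} ε_k / k!` (with the signs indexed from zero). -/
noncomputable def signSum (ε : ℕ → ℝ) : ℝ := ∑' k : ℕ, ε k / ((k + 1).factorial : ℝ)

@[fun_prop]
theorem measurable_signPartialSum (n : ℕ) : Measurable (signPartialSum n) := by
  unfold signPartialSum; fun_prop

@[fun_prop]
theorem measurable_signSum : Measurable signSum := by
  unfold signSum; fun_prop

theorem bernoulliConv_eq_map : bernoulliConv = signLaw.map signSum := rfl

theorem abs_eq_one_of_mem_signSequences {ε : ℕ → ℝ} (hε : ε ∈ signSequences) (k : ℕ) :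
    |ε k| = 1 := by
  rcases hε k with h | h <;> simp [h]

theorem tendsto_signPartialSum {ε : ℕ → ℝ} (hε : ε ∈ signSequences) :
    Tendsto (fun n => signPartialSum n ε) atTop (𝓝 (signSum ε)) := by
  refine Summable.tendsto_sum_tsum_nat ?_
  have hs : Summable fun k : ℕ => 1 / ((k + 1).factorial : ℝ) := by
    simpa using (summable_nat_add_iff 1).2 (Real.summable_pow_div_factorial 1)
  refine hs.of_norm_bounded fun k => ?_
  simp [abs_eq_one_of_mem_signSequences hε]

theorem abs_signPartialSum_succ_sub {ε : ℕ → ℝ} (hε : ε ∈ signSequences) (k : ℕ) :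
    |signPartialSum (k + 1) ε - signPartialSum k ε| ≤ 1 / ((k + 1).factorial : ℝ) := by
  simp [signPartialSum, Finset.sum_range_succ, abs_div, abs_eq_one_of_mem_signSequences hε]

/-! ### The infinite convolution has no atoms -/

/-- Distinct sign sequences have distinct sums: a term `1 / k!` exceeds the sum of all later ones,
so the sums are separated by the first sign in which the sequences differ. -/
theorem injOn_signSum : Set.InjOn signSum signSequences := by
  classical
  intro ε hε δ hδ hsum
  by_contra hne
  have hex : ∃ k, ε k ≠ δ k := Function.ne_iff.1 hne
  set k := Nat.find hex with hk
  have hk1 : ε k ≠ δ k := Nat.find_spec hex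
  have hlt : ∀ j < k, ε j = δ j := fun j hj => not_not.1 (Nat.find_min hex hj)
  have h1 := abs_sub_le_of_factorial_increments (abs_signPartialSum_succ_sub hε)
    (tendsto_signPartialSum hε) (k + 1)
  have h2 := abs_sub_le_of_factorial_increments (abs_signPartialSum_succ_sub hδ)
    (tendsto_signPartialSum hδ) (k + 1)
  rw [hsum] at h1
  have hdiff : signPartialSum (k + 1) ε - signPartialSum (k + 1) δ =
      (ε k - δ k) / ((k + 1).factorial : ℝ) := by
    have : signPartialSum k ε = signPartialSum k δ :=
      Finset.sum_congr rfl fun j hj => by rw [hlt j (Finset.mem_range.1 hj)]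
    unfold signPartialSum at this ⊢
    rw [Finset.sum_range_succ, Finset.sum_range_succ, this]
    ring
  have habs : |signPartialSum (k + 1) ε - signPartialSum (k + 1) δ| =
      2 / ((k + 1).factorial : ℝ) := by
    rw [hdiff, abs_div, Nat.abs_cast]
    congr 1
    rcases hε k with h | h <;> rcases hδ k with h' | h' <;> rw [h, h'] at hk1 ⊢ <;> norm_num at *
  have h3 := abs_sub_le (signPartialSum (k + 1) ε) (signSum δ) (signPartialSum (k + 1) δ)
  rw [habs, abs_sub_comm _ (signSum δ)] at h3
  have h4 : 2 / ((k + 1).factorial : ℝ) ≤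
      2 * ((1 + 1 / (((k + 1 : ℕ) : ℝ) + 1)) / ((k + 1 + 1).factorial : ℝ)) := by linarith
  have hf : (0 : ℝ) < (k + 1).factorial := by positivity
  rw [Nat.factorial_succ (k + 1)] at h4
  push_cast at h4
  have hk0 : (0 : ℝ) ≤ k := k.cast_nonneg
  have h5 : 2 * ((1 + 1 / ((k : ℝ) + 1 + 1)) / (((k : ℝ) + 1 + 1) * (k + 1).factorial)) <
      2 / ((k + 1).factorial : ℝ) := by
    rw [show 2 * ((1 + 1 / ((k : ℝ) + 1 + 1)) / (((k : ℝ) + 1 + 1) * (k + 1).factorial)) =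
      2 * ((k + 3) / (k + 2) ^ 2) / ((k + 1).factorial : ℝ) by field_simp; ring]
    have : ((k : ℝ) + 3) / (k + 2) ^ 2 < 1 := by
      rw [div_lt_one (by positivity)]
      nlinarith
    gcongr
    linarith
  linarith

theorem symBernoulli_one_singleton_le (x : ℝ) : symBernoulli 1 {x} ≤ 2⁻¹ := by
  by_cases h1 : x = 1
  · subst h1
    simp [symBernoulli, show (-1 : ℝ) ≠ 1 by norm_num]
  · by_cases h2 : x = -1
    · subst h2
      simp [symBernoulli, show (1 : ℝ) ≠ -1 by norm_num]
    · simp [symBernoulli, Ne.symm h1, Ne.symm h2]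

theorem signLaw_singleton (ε : ℕ → ℝ) : signLaw {ε} = 0 := by
  have hle : ∀ n : ℕ, signLaw {ε} ≤ (2⁻¹ : ENNReal) ^ n := by
    intro n
    calc signLaw {ε} ≤ signLaw ((Finset.range n : Set ℕ).pi fun k => {ε k}) :=
          measure_mono (by rintro _ rfl; simp)
      _ = ∏ k ∈ Finset.range n, symBernoulli 1 {ε k} := by
          rw [signLaw, Measure.infinitePi_pi _ fun k _ => measurableSet_singleton _]
      _ ≤ ∏ _k ∈ Finset.range n, 2⁻¹ :=
          Finset.prod_le_prod' fun k _ => symBernoulli_one_singleton_le _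
      _ = 2⁻¹ ^ n := by simp
  have hlim : Tendsto (fun n : ℕ => (2⁻¹ : ENNReal) ^ n) atTop (𝓝 0) :=
    ENNReal.tendsto_pow_atTop_nhds_zero_of_lt_one (by simp)
  exact le_antisymm (ge_of_tendsto' hlim hle) zero_le

theorem bernoulliConv_singleton (x : ℝ) : bernoulliConv {x} = 0 := by
  rw [bernoulliConv_eq_map, Measure.map_apply measurable_signSum (measurableSet_singleton x)]
  have hsub : (signSequences ∩ signSum ⁻¹' {x}).Subsingleton := fun ε hε δ hδ =>
    injOn_signSum hε.1 hδ.1 (hε.2.trans hδ.2.symm)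
  have hzero : signLaw (signSequences ∩ signSum ⁻¹' {x}) = 0 := by
    rcases hsub.eq_empty_or_singleton with h | ⟨ε, h⟩
    · rw [h, measure_empty]
    · rw [h, signLaw_singleton]
  have hae : ∀ᵐ ε ∂signLaw, ε ∉ signSum ⁻¹' {x} := by
    filter_upwards [ae_mem_signSequences, measure_eq_zero_iff_ae_notMem.1 hzero] with ε h1 h2 h3
    exact h2 ⟨h1, h3⟩
  exact measure_eq_zero_iff_ae_notMem.2 hae

/-! ### The infinite convolution is singular -/

/-- The points `∑_{k ≤ n} ± 1 / k!`. -/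
noncomputable def signPartialSumValues : ℕ → Finset ℝ
  | 0 => {0}
  | n + 1 => (signPartialSumValues n).image (fun y => y + -1 / ((n + 1).factorial : ℝ)) ∪
      (signPartialSumValues n).image (fun y => y + 1 / ((n + 1).factorial : ℝ))

theorem card_signPartialSumValues_le (n : ℕ) : (signPartialSumValues n).card ≤ 2 ^ n := by
  induction n with
  | zero => simp [signPartialSumValues]
  | succ n ih =>
    refine (Finset.card_union_le _ _).trans ?_
    rw [pow_succ, mul_two]
    exact add_le_add (Finset.card_image_le.trans ih) (Finset.card_image_le.trans ih)

theorem signPartialSum_mem_values {ε : ℕ → ℝ} (hε : ε ∈ signSequences) (n : ℕ) :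
    signPartialSum n ε ∈ signPartialSumValues n := by
  induction n with
  | zero => simp [signPartialSum, signPartialSumValues]
  | succ n ih =>
    have h : signPartialSum (n + 1) ε = signPartialSum n ε + ε n / ((n + 1).factorial : ℝ) :=
      Finset.sum_range_succ _ _
    rw [h, signPartialSumValues, Finset.mem_union, Finset.mem_image, Finset.mem_image]
    rcases hε n with h' | h' <;> rw [h']
    · exact Or.inl ⟨_, ih, rfl⟩
    · exact Or.inr ⟨_, ih, rfl⟩

/-- A union of at most `2 ^ n` intervals that contains every sum `∑_k ± 1 / k!`. -/
def signSumCover (n : ℕ) : Set ℝ :=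
  ⋃ y ∈ signPartialSumValues n, Metric.closedBall y (2 / ((n + 1).factorial : ℝ))

theorem signSum_mem_cover {ε : ℕ → ℝ} (hε : ε ∈ signSequences) (n : ℕ) :
    signSum ε ∈ signSumCover n := by
  refine Set.mem_iUnion₂.2 ⟨_, signPartialSum_mem_values hε n, ?_⟩
  rw [Metric.mem_closedBall, Real.dist_eq]
  simpa using abs_sub_le_two_mul_of_factorial_increments (abs_signPartialSum_succ_sub hε)
    (tendsto_signPartialSum hε) n

theorem volume_signSumCover_le (n : ℕ) :
    volume (signSumCover n) ≤ ENNReal.ofReal (2 * (2 ^ (n + 1) / ((n + 1).factorial : ℝ))) := by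
  calc volume (signSumCover n)
      ≤ ∑ y ∈ signPartialSumValues n,
          volume (Metric.closedBall y (2 / ((n + 1).factorial : ℝ))) :=
        measure_biUnion_finset_le _ _
    _ = (signPartialSumValues n).card * ENNReal.ofReal (2 * (2 / ((n + 1).factorial : ℝ))) := by
        simp [Real.volume_closedBall]
    _ ≤ (2 ^ n : ℕ) * ENNReal.ofReal (2 * (2 / ((n + 1).factorial : ℝ))) := by
        gcongr
        exact card_signPartialSumValues_le n
    _ = ENNReal.ofReal (2 * (2 ^ (n + 1) / ((n + 1).factorial : ℝ))) := by
        rw [← ENNReal.ofReal_natCast, ← ENNReal.ofReal_mul (Nat.cast_nonneg _)]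
        push_cast
        congr 1
        ring

theorem bernoulliConv_mutuallySingular : bernoulliConv.MutuallySingular volume := by
  have hmeas : MeasurableSet (⋂ n, signSumCover n) := by
    refine MeasurableSet.iInter fun n => Finset.measurableSet_biUnion _ fun y _ => ?_
    exact measurableSet_closedBall
  refine ⟨(⋂ n, signSumCover n)ᶜ, hmeas.compl, ?_, ?_⟩
  · rw [bernoulliConv_eq_map, Measure.map_apply measurable_signSum hmeas.compl]
    refine measure_eq_zero_iff_ae_notMem.2 ?_
    filter_upwards [ae_mem_signSequences] with ε hε h
    exact h (Set.mem_iInter.2 (signSum_mem_cover hε))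
  · rw [compl_compl]
    have hlim : Tendsto (fun n : ℕ =>
        ENNReal.ofReal (2 * (2 ^ (n + 1) / ((n + 1).factorial : ℝ)))) atTop (𝓝 0) := by
      have h := ((tendsto_add_atTop_iff_nat 1).2
        (FloorSemiring.tendsto_pow_div_factorial_atTop (2 : ℝ))).const_mul 2
      simpa using ENNReal.tendsto_ofReal h
    exact le_antisymm (ge_of_tendsto' hlim fun n =>
      (measure_mono (Set.iInter_subset _ n)).trans (volume_signSumCover_le n)) zero_le

/-! ### The characteristic function of the infinite convolution -/

theorem charFun_symBernoulli (a t : ℝ) : charFun (symBernoulli a) t = (Real.cos (t * a) : ℝ) := by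
  have hd : ∀ x : ℝ, Integrable (fun y : ℝ => Complex.exp (t * y * Complex.I))
      (Measure.dirac x) := fun x => integrable_dirac (by simp)
  rw [charFun_apply_real, symBernoulli, integral_add_measure ((hd _).smul_measure (by simp))
    ((hd _).smul_measure (by simp)), integral_smul_measure, integral_smul_measure, integral_dirac,
    integral_dirac, Complex.ofReal_cos, Complex.cos]
  simp
  ring

theorem charFun_bernoulliPartialConv (n : ℕ) (t : ℝ) :
    charFun (bernoulliPartialConv n) t =
      ((∏ k ∈ Finset.range n, Real.cos (t / ((k + 1).factorial : ℝ)) : ℝ) : ℂ) := by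
  induction n with
  | zero => simp [bernoulliPartialConv, charFun_dirac]
  | succ n ih =>
    rw [bernoulliPartialConv, charFun_conv, ih, charFun_symBernoulli, Finset.prod_range_succ,
      Complex.ofReal_mul, mul_one_div]

theorem charFun_map_signPartialSum (n : ℕ) (t : ℝ) :
    charFun (signLaw.map (signPartialSum n)) t =
      ((∏ k ∈ Finset.range n, Real.cos (t / ((k + 1).factorial : ℝ)) : ℝ) : ℂ) := by
  have hind : ProbabilityTheory.iIndepFun
      (fun (k : ℕ) (ε : ℕ → ℝ) => (((k + 1).factorial : ℝ))⁻¹ * ε k) signLaw :=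
    ProbabilityTheory.iIndepFun_infinitePi (P := fun _ : ℕ => symBernoulli 1)
      (X := fun k x => (((k + 1).factorial : ℝ))⁻¹ * x) (fun k => by fun_prop)
  have hres : ProbabilityTheory.iIndepFun ((Finset.range n).restrict
      fun (k : ℕ) (ε : ℕ → ℝ) => (((k + 1).factorial : ℝ))⁻¹ * ε k) signLaw :=
    hind.precomp (g := fun i : Finset.range n => (i : ℕ)) Subtype.val_injective
  have hfun : signPartialSum n =
      fun ε => ∑ k ∈ Finset.range n, (((k + 1).factorial : ℝ))⁻¹ * ε k := by
    funext ε
    exact Finset.sum_congr rfl fun k _ => div_eq_inv_mul _ _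
  rw [hfun, ProbabilityTheory.iIndepFun.charFun_map_fun_finsetSum_eq_prod
    (fun k _ => ((measurable_pi_apply k).const_mul _).aemeasurable) hres,
    Finset.prod_apply, Complex.ofReal_prod]
  refine Finset.prod_congr rfl fun k _ => ?_
  have hmap : signLaw.map (fun ε => (((k + 1).factorial : ℝ))⁻¹ * ε k) =
      (symBernoulli 1).map (fun x => (((k + 1).factorial : ℝ))⁻¹ * x) := by
    rw [← Measure.infinitePi_map_eval (fun _ : ℕ => symBernoulli 1) k,
      Measure.map_map (by fun_prop) (by fun_prop)]
    rfl
  rw [hmap, charFun_map_mul, charFun_symBernoulli, mul_one, div_eq_inv_mul]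

theorem tendsto_prod_cos (t : ℝ) :
    Tendsto (fun n => ((∏ k ∈ Finset.range n, Real.cos (t / ((k + 1).factorial : ℝ)) : ℝ) : ℂ))
      atTop (𝓝 (charFun bernoulliConv t)) := by
  have hmap : ∀ f : (ℕ → ℝ) → ℝ, Measurable f → charFun (signLaw.map f) t =
      ∫ ε, Complex.exp (t * f ε * Complex.I) ∂signLaw := fun f hf => by
    rw [charFun_apply_real, integral_map hf.aemeasurable (by fun_prop)]
  simp only [← charFun_map_signPartialSum, bernoulliConv_eq_map]
  rw [hmap _ measurable_signSum]
  simp only [hmap _ (measurable_signPartialSum _)]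
  refine tendsto_integral_of_dominated_convergence (fun _ => 1) (fun n => by fun_prop)
    (integrable_const 1) (fun n => Eventually.of_forall fun ε => ?_) ?_
  · rw [← Complex.ofReal_mul, Complex.norm_exp_ofReal_mul_I]
  · filter_upwards [ae_mem_signSequences] with ε hε
    have hcont : Continuous fun x : ℝ => Complex.exp (t * x * Complex.I) := by fun_prop
    exact (hcont.tendsto _).comp (tendsto_signPartialSum hε)

theorem multipliable_cos_div_factorial (t : ℝ) :
    Multipliable fun k : ℕ => ((Real.cos (t / ((k + 1).factorial : ℝ)) : ℝ) : ℂ) := by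
  have hs : Summable fun k : ℕ => |t| / ((k + 1).factorial : ℝ) := by
    have := ((summable_nat_add_iff 1).2 (Real.summable_pow_div_factorial 1)).mul_left |t|
    simpa [div_eq_mul_inv] using this
  have h := multipliable_one_add_of_summable
    (f := fun k : ℕ => ((Real.cos (t / ((k + 1).factorial : ℝ)) - 1 : ℝ) : ℂ)) <|
      hs.of_nonneg_of_le (fun k => norm_nonneg _) fun k => by
        rw [Complex.norm_real, Real.norm_eq_abs]
        simpa [abs_div] using Real.abs_cos_sub_cos_le (t / ((k + 1).factorial : ℝ)) 0
  convert h using 2 with k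
  push_cast
  ring

theorem hasProd_charFun_bernoulliConv (t : ℝ) :
    HasProd (fun k : ℕ => ((Real.cos (t / ((k + 1).factorial : ℝ)) : ℝ) : ℂ))
      (charFun bernoulliConv t) := by
  have h := (multipliable_cos_div_factorial t).hasProd
  have hlim := tendsto_prod_cos t
  simp only [Complex.ofReal_prod] at hlim
  rwa [tendsto_nhds_unique h.tendsto_prod_nat hlim] at h

theorem tendsto_bernoulliPartialConv :
    Tendsto (β := ProbabilityMeasure ℝ) (fun n : ℕ => ⟨bernoulliPartialConv n, inferInstance⟩) atTop
        (@nhds (ProbabilityMeasure ℝ) _ ⟨bernoulliConv, inferInstance⟩) := by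
  refine ProbabilityMeasure.tendsto_iff_tendsto_charFun.2 fun t => ?_
  simpa only [ProbabilityMeasure.coe_mk, charFun_bernoulliPartialConv] using tendsto_prod_cos t

/-- The partial product `∏_{k ≤ n} cos (t / k!)`. -/
noncomputable def cosPartialProd (n : ℕ) (t : ℝ) : ℝ :=
  ∏ k ∈ Finset.range n, Real.cos (t / ((k + 1).factorial : ℝ))

/-- The infinite product `∏_{k ≥ 1} cos (t / k!)`, that is, the characteristic function of
`bernoulliConv` as a real function. -/
noncomputable def cosProd (t : ℝ) : ℝ := (charFun bernoulliConv t).re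

theorem tendsto_cosPartialProd (t : ℝ) :
    Tendsto (fun n => cosPartialProd n t) atTop (𝓝 (cosProd t)) :=
  (Complex.continuous_re.tendsto _).comp (tendsto_prod_cos t)

theorem charFun_bernoulliConv_eq (t : ℝ) : charFun bernoulliConv t = (cosProd t : ℂ) :=
  tendsto_nhds_unique (tendsto_prod_cos t)
    ((Complex.continuous_ofReal.tendsto _).comp (tendsto_cosPartialProd t))

theorem abs_cosPartialProd_le_one (n : ℕ) (t : ℝ) : |cosPartialProd n t| ≤ 1 := by
  rw [cosPartialProd, Finset.abs_prod]
  exact Finset.prod_le_one (fun _ _ => abs_nonneg _) fun _ _ => Real.abs_cos_le_one _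

theorem abs_cosPartialProd_succ_sub (t : ℝ) (k : ℕ) :
    |cosPartialProd (k + 1) t - cosPartialProd k t| ≤ |t| / ((k + 1).factorial : ℝ) := by
  have h : cosPartialProd (k + 1) t - cosPartialProd k t =
      cosPartialProd k t * (Real.cos (t / ((k + 1).factorial : ℝ)) - Real.cos 0) := by
    rw [cosPartialProd, Finset.prod_range_succ, ← cosPartialProd, Real.cos_zero]
    ring
  rw [h, abs_mul]
  have h1 := Real.abs_cos_sub_cos_le (t / ((k + 1).factorial : ℝ)) 0
  rw [sub_zero, abs_div, Nat.abs_cast] at h1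
  exact (mul_le_of_le_one_left (abs_nonneg _) (abs_cosPartialProd_le_one k t)).trans h1

theorem abs_cosProd_sub_cosPartialProd_le (n : ℕ) (t : ℝ) :
    |cosProd t - cosPartialProd n t| ≤ |t| * (2 / ((n + 1).factorial : ℝ)) :=
  abs_sub_le_two_mul_of_factorial_increments (abs_cosPartialProd_succ_sub t)
    (tendsto_cosPartialProd t) n

theorem abs_cosProd_le_abs_cos (t : ℝ) (k : ℕ) :
    |cosProd t| ≤ |Real.cos (t / ((k + 1).factorial : ℝ))| := by
  refine le_of_tendsto (tendsto_cosPartialProd t).abs ?_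
  filter_upwards [eventually_gt_atTop k] with n hn
  rw [cosPartialProd, ← Finset.mul_prod_erase _ _ (Finset.mem_range.2 hn), abs_mul,
    Finset.abs_prod]
  exact mul_le_of_le_one_right (abs_nonneg _)
    (Finset.prod_le_one (fun _ _ => abs_nonneg _) fun _ _ => Real.abs_cos_le_one _)

/-- A factor `cos (t / k!)` with `|t| / k! < π` and `t ≠ 0` has modulus less than one. -/
theorem abs_cosProd_lt_one {t : ℝ} (ht : t ≠ 0) : |cosProd t| < 1 := by
  have hlim : Tendsto (fun k : ℕ => |t| / ((k : ℝ))) atTop (𝓝 0) :=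
    tendsto_const_div_atTop_nhds_zero_nat _
  obtain ⟨k, hk, hk1⟩ := ((hlim.eventually_lt_const Real.pi_pos).and
    (eventually_gt_atTop 0)).exists
  have hk0 : (0 : ℝ) < k := by exact_mod_cast hk1
  refine (abs_cosProd_le_abs_cos t k).trans_lt ?_
  set x := t / ((k + 1).factorial : ℝ) with hx
  have hx0 : x ≠ 0 := by positivity
  have hxpi : |x| < Real.pi := by
    refine lt_of_le_of_lt ?_ hk
    rw [hx, abs_div, Nat.abs_cast]
    gcongr
    exact_mod_cast (Nat.le_succ k).trans (Nat.self_le_factorial (k + 1))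
  have hsin : Real.sin x ≠ 0 := fun h =>
    hx0 ((Real.sin_eq_zero_iff_of_lt_of_lt (abs_lt.1 hxpi).1 (abs_lt.1 hxpi).2).1 h)
  rw [← sq_lt_one_iff_abs_lt_one]
  have : 0 < Real.sin x ^ 2 := by positivity
  linarith [Real.sin_sq_add_cos_sq x]

theorem cosProd_zero : cosProd 0 = 1 := by
  rw [cosProd, charFun_zero, probReal_univ, Complex.ofReal_re]

theorem neg_one_lt_cosProd (t : ℝ) : -1 < cosProd t := by
  rcases eq_or_ne t 0 with rfl | ht
  · rw [cosProd_zero]; norm_num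
  · exact (abs_lt.1 (abs_cosProd_lt_one ht)).1

/-! ### Antiperiodicity in the limit -/

/-- For even `N` the shift by `π N!` changes the sign of the factor `cos (t / N!)` only: for
`k < N` the quotient `N! / k!` is a multiple of `N`, hence even. -/
theorem cosPartialProd_add_pi_mul_factorial {N : ℕ} (hN : Even N) (hpos : 0 < N) (s : ℝ) :
    cosPartialProd N (s + Real.pi * (N.factorial : ℝ)) = -cosPartialProd N s := by
  obtain ⟨M, rfl⟩ : ∃ M, N = M + 1 := ⟨N - 1, by omega⟩
  have hlast : Real.cos ((s + Real.pi * ((M + 1).factorial : ℝ)) / ((M + 1).factorial : ℝ)) =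
      -Real.cos (s / ((M + 1).factorial : ℝ)) := by
    rw [add_div, mul_div_cancel_right₀ _ (by positivity), Real.cos_add_pi]
  have hinit : ∀ k ∈ Finset.range M,
      Real.cos ((s + Real.pi * ((M + 1).factorial : ℝ)) / ((k + 1).factorial : ℝ)) =
        Real.cos (s / ((k + 1).factorial : ℝ)) := by
    intro k hk
    obtain ⟨q, hq⟩ := Nat.factorial_dvd_factorial (Nat.succ_le_of_lt (Finset.mem_range.1 hk))
    have hfac : (M + 1).factorial = (k + 1).factorial * ((M + 1) * q) := by
      rw [Nat.factorial_succ M, hq]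
      ring
    have he : Even ((M + 1) * q) := hN.mul_right q
    rw [hfac, Nat.cast_mul, add_div, ← mul_assoc, mul_right_comm,
      mul_div_cancel_right₀ _ (by positivity), mul_comm Real.pi, Real.cos_add_nat_mul_pi,
      he.neg_one_pow, one_mul]
  rw [cosPartialProd, cosPartialProd, Finset.prod_range_succ, Finset.prod_range_succ, hlast,
    Finset.prod_congr rfl hinit, mul_neg]

theorem tendsto_cosProd_add_pi_mul_factorial (s : ℝ) :
    Tendsto (fun m : ℕ => cosProd (s + Real.pi * ((2 * (m + 1)).factorial : ℝ))) atTop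
      (𝓝 (-cosProd s)) := by
  have hN : Tendsto (fun m : ℕ => 2 * (m + 1)) atTop atTop :=
    tendsto_atTop_mono (fun m => by rw [id]; omega) tendsto_id
  have hdiff : Tendsto (fun m : ℕ => cosProd (s + Real.pi * ((2 * (m + 1)).factorial : ℝ)) -
      cosPartialProd (2 * (m + 1)) (s + Real.pi * ((2 * (m + 1)).factorial : ℝ))) atTop
      (𝓝 0) := by
    have hlim : Tendsto (fun m : ℕ => (2 * (|s| + Real.pi)) / ((m : ℝ))) atTop (𝓝 0) :=
      tendsto_const_div_atTop_nhds_zero_nat _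
    refine squeeze_zero_norm' ?_ hlim
    filter_upwards [eventually_gt_atTop 0] with m hm
    refine (abs_cosProd_sub_cosPartialProd_le _ _).trans ?_
    have hf : (1 : ℝ) ≤ ((2 * (m + 1)).factorial : ℝ) := by
      exact_mod_cast (2 * (m + 1)).factorial_pos
    have hm0 : (0 : ℝ) < m := by exact_mod_cast hm
    have habs : |s + Real.pi * ((2 * (m + 1)).factorial : ℝ)| ≤
        (|s| + Real.pi) * ((2 * (m + 1)).factorial : ℝ) := by
      refine (abs_add_le _ _).trans ?_
      rw [abs_of_pos (by positivity : 0 < Real.pi * ((2 * (m + 1)).factorial : ℝ)), add_mul]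
      nlinarith [abs_nonneg s]
    calc |s + Real.pi * ((2 * (m + 1)).factorial : ℝ)| *
          (2 / ((2 * (m + 1) + 1).factorial : ℝ))
        ≤ ((|s| + Real.pi) * ((2 * (m + 1)).factorial : ℝ)) *
          (2 / ((2 * (m + 1) + 1).factorial : ℝ)) := by gcongr
      _ = (2 * (|s| + Real.pi)) / ((2 * (m + 1) + 1 : ℕ) : ℝ) := by
          rw [Nat.factorial_succ (2 * (m + 1)), Nat.cast_mul]
          field_simp
      _ ≤ (2 * (|s| + Real.pi)) / (m : ℝ) := by
          gcongr
          omega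
  have hmain := ((tendsto_cosPartialProd s).comp hN).neg
  have hsum := hdiff.add hmain
  rw [zero_add] at hsum
  refine hsum.congr fun m => ?_
  rw [cosPartialProd_add_pi_mul_factorial (even_two_mul _) (by omega), Function.comp_apply]
  ring

/-! ### The mixture with the point mass at zero -/

instance isProbabilityMeasure_starLaw : IsProbabilityMeasure starLaw :=
  ⟨by simp [starLaw, ENNReal.inv_two_add_inv_two]⟩

theorem charFun_starLaw (t : ℝ) : charFun starLaw t = (((1 + cosProd t) / 2 : ℝ) : ℂ) := by
  have hint : ∀ μ : Measure ℝ, IsProbabilityMeasure μ →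
      Integrable (fun y : ℝ => Complex.exp (t * y * Complex.I)) μ := fun μ _ =>
    Integrable.of_bound (by fun_prop) 1 (Eventually.of_forall fun y => by
      rw [← Complex.ofReal_mul, Complex.norm_exp_ofReal_mul_I])
  rw [charFun_apply_real, starLaw,
    integral_add_measure ((hint _ inferInstance).smul_measure (by simp))
      ((hint _ inferInstance).smul_measure (by simp)),
    integral_smul_measure, integral_smul_measure, integral_dirac, ← charFun_apply_real,
    charFun_bernoulliConv_eq]
  simp
  ring

theorem norm_charFun_starLaw (t : ℝ) : ‖charFun starLaw t‖ = (1 + cosProd t) / 2 := by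
  rw [charFun_starLaw, Complex.norm_real, Real.norm_of_nonneg]
  linarith [neg_one_lt_cosProd t]

theorem charFun_starLaw_ne_zero (t : ℝ) : charFun starLaw t ≠ 0 := by
  rw [← norm_pos_iff, norm_charFun_starLaw]
  linarith [neg_one_lt_cosProd t]

/-- Along `t = π N!` with `N` even, `f t` tends to zero while `f (t ± 1)` tends to
`(1 - g 1) / 2 > 0`, where `g` is the infinite product of cosines. Hence the second differences of
`log |f|²` with step `1` are unbounded. -/
theorem starLaw_notMem_ClassQ : starLaw ∉ ClassQ := by
  intro hQ
  obtain ⟨C, hC⟩ := exists_abs_second_difference_log_le_of_mem_ClassQ hQ 1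
  set τ : ℕ → ℝ := fun m => Real.pi * ((2 * (m + 1)).factorial : ℝ)
  have hlim : ∀ s, Tendsto (fun m => ‖charFun starLaw (τ m + s)‖ ^ 2) atTop
      (𝓝 (((1 - cosProd s) / 2) ^ 2)) := fun s => by
    simp only [norm_charFun_starLaw, add_comm _ s, sub_eq_add_neg]
    exact (((tendsto_cosProd_add_pi_mul_factorial s).const_add 1).div_const 2).pow 2
  have hlog : ∀ s, s ≠ 0 → Tendsto (fun m => Real.log (‖charFun starLaw (τ m + s)‖ ^ 2)) atTop
      (𝓝 (Real.log (((1 - cosProd s) / 2) ^ 2))) := fun s hs => by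
    refine (hlim s).log (pow_ne_zero 2 ?_)
    linarith [(abs_lt.1 (abs_cosProd_lt_one hs)).2]
  have hbot : Tendsto (fun m => Real.log (‖charFun starLaw (τ m)‖ ^ 2)) atTop atBot := by
    refine Real.tendsto_log_nhdsGT_zero.comp (tendsto_nhdsWithin_iff.2 ⟨?_, ?_⟩)
    · simpa [cosProd_zero] using hlim 0
    · refine Eventually.of_forall fun m => ?_
      have := charFun_starLaw_ne_zero (τ m)
      simp only [Set.mem_Ioi]
      positivity
  have hbdd : ∀ m, Real.log (‖charFun starLaw (τ m + 1)‖ ^ 2) +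
      Real.log (‖charFun starLaw (τ m + -1)‖ ^ 2) - C ≤
        2 * Real.log (‖charFun starLaw (τ m)‖ ^ 2) := fun m => by
    rw [← sub_eq_add_neg]
    linarith [(abs_le.1 (hC (τ m))).2]
  exact not_tendsto_nhds_of_tendsto_atBot
    (tendsto_atBot_mono hbdd (hbot.const_mul_atBot two_pos)) _
    (((hlog 1 one_ne_zero).add (hlog (-1) (by norm_num))).sub_const C)

/-! ### The Lebesgue decomposition of the mixture -/

theorem starLaw_mutuallySingular : starLaw.MutuallySingular volume := by
  refine Measure.MutuallySingular.add_left (Measure.MutuallySingular.smul _ ?_)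
    (bernoulliConv_mutuallySingular.smul _)
  exact mutuallySingular_dirac 0 volume

theorem atomSet_starLaw : atomSet starLaw = {0} := by
  ext x
  by_cases hx : x = 0
  · simp [atomSet, starLaw, hx]
  · simp [atomSet, starLaw, bernoulliConv_singleton, hx, Ne.symm hx]

theorem starLaw_singleton_zero : starLaw {0} = 2⁻¹ := by
  simp [starLaw, bernoulliConv_singleton]

theorem discreteWeight_starLaw : discreteWeight starLaw = 1 / 2 := by
  rw [discreteWeight, atomSet_starLaw, measureReal_def, starLaw_singleton_zero]
  simp

theorem absContWeight_starLaw : absContWeight starLaw = 0 := by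
  rw [absContWeight, (Measure.withDensity_rnDeriv_eq_zero _ _).2 starLaw_mutuallySingular]
  simp

theorem contSingWeight_starLaw : contSingWeight starLaw = 1 / 2 := by
  have h := discreteWeight_starLaw
  rw [discreteWeight, atomSet_starLaw] at h
  rw [contSingWeight, Measure.singularPart_eq_self.2 starLaw_mutuallySingular, atomSet_starLaw,
    probReal_compl_eq_one_sub (measurableSet_singleton 0), h]
  norm_num

theorem discreteLaw_starLaw : discreteLaw starLaw = Measure.dirac 0 := by
  rw [discreteLaw, atomSet_starLaw, Measure.restrict_singleton, smul_smul, starLaw_singleton_zero,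
    ENNReal.inv_mul_cancel (by simp) (by simp), one_smul]

theorem charFun_discreteLaw_starLaw (t : ℝ) : charFun (discreteLaw starLaw) t = 1 := by
  simp [discreteLaw_starLaw, charFun_dirac]

theorem discreteInf_starLaw : discreteInf starLaw = 1 := by
  simp [discreteInf, charFun_discreteLaw_starLaw]

/-! ### Failure of the criterion without domination -/

theorem proposition2 :
    -- the infinite Bernoulli convolution `F_s`, its characteristic function, and its type
    (Tendsto (β := ProbabilityMeasure ℝ) (fun n : ℕ => ⟨bernoulliPartialConv n, inferInstance⟩) atTop
        (@nhds (ProbabilityMeasure ℝ) _ ⟨bernoulliConv, inferInstance⟩) ∧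
      (∀ t : ℝ, HasProd (fun k : ℕ => ((Real.cos (t / ((k + 1).factorial : ℝ)) : ℝ) : ℂ))
        (charFun bernoulliConv t)) ∧
      (∀ x : ℝ, bernoulliConv {x} = 0) ∧
      bernoulliConv.MutuallySingular volume) ∧
    -- `F_*` does not belong to the class `Q`
    (IsProbabilityMeasure starLaw ∧ starLaw ∉ ClassQ) ∧
    -- its characteristic function has no real zeros
    (∀ t : ℝ, charFun starLaw t ≠ 0) ∧
    -- its Lebesgue decomposition, `μ_d = 1`, and the failure of the domination condition
    (discreteWeight starLaw = 1 / 2 ∧ absContWeight starLaw = 0 ∧ contSingWeight starLaw = 1 / 2 ∧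
      (∀ t : ℝ, charFun (discreteLaw starLaw) t = 1) ∧
      discreteInf starLaw = 1 ∧
      contSingWeight starLaw = discreteWeight starLaw * discreteInf starLaw ∧
      ¬ HasDominatedSingularPart starLaw) ∧
    -- the criterion for membership in `Q` is false when the domination condition is replaced by
    -- `c_s = c_d μ_d` with `μ_d > 0`
    (¬ ∀ F : Measure ℝ, IsProbabilityMeasure F → 0 < discreteWeight F → 0 < discreteInf F →
        contSingWeight F = discreteWeight F * discreteInf F →
        (F ∈ ClassQ ↔
          (∀ t : ℝ, charFun F t ≠ 0) ∧ 0 < discreteInf F)) := by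
  have hfail : contSingWeight starLaw = discreteWeight starLaw * discreteInf starLaw := by
    rw [contSingWeight_starLaw, discreteWeight_starLaw, discreteInf_starLaw, mul_one]
  refine ⟨⟨tendsto_bernoulliPartialConv, hasProd_charFun_bernoulliConv, bernoulliConv_singleton,
      bernoulliConv_mutuallySingular⟩,
    ⟨inferInstance, starLaw_notMem_ClassQ⟩, charFun_starLaw_ne_zero,
    ⟨discreteWeight_starLaw, absContWeight_starLaw, contSingWeight_starLaw,
      charFun_discreteLaw_starLaw, discreteInf_starLaw, hfail, fun h => ?_⟩, fun h => ?_⟩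
  · exact (h.1 (by rw [discreteInf_starLaw]; exact one_pos)).ne hfail
  · have hinf : 0 < discreteInf starLaw := by rw [discreteInf_starLaw]; exact one_pos
    have hwt : 0 < discreteWeight starLaw := by rw [discreteWeight_starLaw]; norm_num
    exact starLaw_notMem_ClassQ
      ((h starLaw inferInstance hwt hinf hfail).2 ⟨charFun_starLaw_ne_zero, hinf⟩)
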